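/- Let $\mathcal{M}$ be a von Neumann algebra on a complex Hilbert space $H$, equipped with a faithful normal semifinite trace $\tau$. Let $S(\tau)$ be the $*$-algebra of $\tau$-measurable operators, that is, of the closed densely defined operators $x$ on $H$ that are affiliated with $\mathcal{M}$ and satisfy $\tau(e^{|x|}(\lambda,\infty))<\infty$ for some $\lambda>0$, where $e^{|x|}$ is the spectral measure of $|x|$; sums and products are the strong ones (closures of the algebraic ones). An operator $x\in S(\tau)$ is $\tau$-compact if $\lim_{t\to\infty}\mu(t;x)=0$, where $\mu(t;x)=\inf\{s\ge 0:\tau(e^{|x|}(s,\infty))\le t\}$. Let $\mathbb{E}$ be a Banach $\mathcal{M}$-bimodule of $\tau$-compact operators: a linear subspace of $S(\tau)$ consisting of (possibly unbounded) $\tau$-compact operators, with a norm $\|\cdot\|_{\mathbb{E}}$ for which it is a Banach space, such that $uxv\in\mathbb{E}$ and $\|uxv\|_{\mathbb{E}}\le\|u\|_{\mathcal{M}}\|v\|_{\mathcal{M}}\|x\|_{\mathbb{E}}$ for all $x\in\mathbb{E}$ and $u,v\in\mathcal{M}$, where $\|\cdot\|_{\mathcal{M}}$ is the operator norm. Then every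 derivation $\delta:\mathcal{M}\to\mathbb{E}$, that is, every linear map with $\delta(xy)=\delta(x)y+x\delta(y)$ for all $x,y\in\mathcal{M}$, is continuous from $(\mathcal{M},\|\cdot\|_{\mathcal{M}})$ to $(\mathbb{E},\|\cdot\|_{\mathbb{E}})$. -/

import Mathlib

open scoped NNReal ENNReal Topology InnerProductSpace

noncomputable section

namespace TauCompact

universe u

variable {H : Type u} [NormedAddCommGroup H] [InnerProductSpace ℂ H] [CompleteSpace H]

/-! ### Unbounded operators

Operators in `H`, possibly unbounded and with a linear subspace of `H` as domain, are Mathlib's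
`LinearPMap`s, and `x ≤ y` means that `y` extends `x`. -/

/-- A bounded operator, as an operator with domain `H`. -/
def ofBounded (u : H →L[ℂ] H) : H →ₗ.[ℂ] H := (u : H →ₗ[ℂ] H).toPMap ⊤

/-- The product `x y` of two operators on its natural domain
`{ξ ∈ 𝔇(y) : y ξ ∈ 𝔇(x)}`. -/
def pmul (x y : H →ₗ.[ℂ] H) : H →ₗ.[ℂ] H where
  domain :=
    { carrier := {ξ | ∃ h : ξ ∈ y.domain, y ⟨ξ, h⟩ ∈ x.domain}
      zero_mem' := ⟨y.domain.zero_mem, by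
        have h : y ⟨0, y.domain.zero_mem⟩ = 0 := y.map_zero
        rw [h]; exact x.domain.zero_mem⟩
      add_mem' := by
        rintro a b ⟨ha, ha'⟩ ⟨hb, hb'⟩
        refine ⟨y.domain.add_mem ha hb, ?_⟩
        have h : y ⟨a + b, y.domain.add_mem ha hb⟩ = y ⟨a, ha⟩ + y ⟨b, hb⟩ :=
          y.map_add ⟨a, ha⟩ ⟨b, hb⟩
        rw [h]; exact x.domain.add_mem ha' hb'
      smul_mem' := by
        rintro c a ⟨ha, ha'⟩
        refine ⟨y.domain.smul_mem c ha, ?_⟩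
        have h : y ⟨c • a, y.domain.smul_mem c ha⟩ = c • y ⟨a, ha⟩ := y.map_smul c ⟨a, ha⟩
        rw [h]; exact x.domain.smul_mem c ha' }
  toFun :=
    { toFun := fun ξ => x ⟨y ⟨ξ.1, ξ.2.1⟩, ξ.2.2⟩
      map_add' := by
        rintro ⟨a, ha, ha'⟩ ⟨b, hb, hb'⟩
        rw [← x.map_add]
        congr 1
        exact Subtype.ext (y.map_add ⟨a, ha⟩ ⟨b, hb⟩)
      map_smul' := by
        rintro c ⟨a, ha, ha'⟩
        rw [RingHom.id_apply, ← x.map_smul]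
        congr 1
        exact Subtype.ext (y.map_smul c ⟨a, ha⟩) }

/-- The strong sum: the closure of the algebraic sum. -/
def strongAdd (x y : H →ₗ.[ℂ] H) : H →ₗ.[ℂ] H := (x + y).closure

/-- The strong product: the closure of the algebraic product. -/
def strongMul (x y : H →ₗ.[ℂ] H) : H →ₗ.[ℂ] H := (pmul x y).closure

/-- The strong scalar multiple: the closure of the algebraic one. (The two differ only for `c = 0`
and an unbounded `x`, where the closure is the zero operator with domain `H`.) -/
def strongSMul (c : ℂ) (x : H →ₗ.[ℂ] H) : H →ₗ.[ℂ] H := (c • x).closure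

/-! ### Spectral measures and the modulus -/

/-- A projection-valued measure on the Borel sets of the real line. The values at sets that are not
Borel are irrelevant. -/
structure ProjMeasure (H : Type u) [NormedAddCommGroup H] [InnerProductSpace ℂ H]
    [CompleteSpace H] where
  /-- The value of the measure at a set. -/
  proj : Set ℝ → (H →L[ℂ] H)
  isStarProjection : ∀ s, MeasurableSet s → IsStarProjection (proj s)
  proj_empty : proj ∅ = 0
  proj_univ : proj Set.univ = 1
  proj_inter : ∀ s t, MeasurableSet s → MeasurableSet t → proj (s ∩ t) = proj s * proj t
  hasSum_iUnion : ∀ f : ℕ → Set ℝ, (∀ n, MeasurableSet (f n)) →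
    Pairwise (Function.onFun Disjoint f) → ∀ ξ : H, HasSum (fun n => proj (f n) ξ) (proj (⋃ n, f n) ξ)

theorem inner_starProjection {p : H →L[ℂ] H} (hp : IsStarProjection p) (ξ : H) :
    (⟪ξ, p ξ⟫_ℂ).re = ‖p ξ‖ ^ 2 := by
  have h1 : ⟪p ξ, p ξ⟫_ℂ = ⟪ξ, p ξ⟫_ℂ := by
    have h2 : ⟪p ξ, p ξ⟫_ℂ = ⟪ξ, (ContinuousLinearMap.adjoint p) (p ξ)⟫_ℂ :=
      (ContinuousLinearMap.adjoint_inner_right p ξ (p ξ)).symm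
    have h3 : ContinuousLinearMap.adjoint p = p := hp.isSelfAdjoint
    have h4 : p (p ξ) = p ξ := by
      have := congrArg (fun q : H →L[ℂ] H => q ξ) hp.isIdempotentElem.eq
      simpa using this
    rw [h2, h3, h4]
  rw [← h1]
  have := inner_self_eq_norm_sq (𝕜 := ℂ) (p ξ)
  simpa using this

/-- The scalar measure `s ↦ ⟪ξ, E(s) ξ⟫ = ‖E(s) ξ‖²` of a projection-valued measure `E`. -/
def ProjMeasure.scalar (E : ProjMeasure H) (ξ : H) : MeasureTheory.Measure ℝ :=
  MeasureTheory.Measure.ofMeasurable (fun s _ => ENNReal.ofReal (‖E.proj s ξ‖ ^ 2))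
    (by simp [E.proj_empty])
    (by
      intro f hf hd
      have hre : HasSum (fun n => ‖E.proj (f n) ξ‖ ^ 2) (‖E.proj (⋃ n, f n) ξ‖ ^ 2) := by
        have h1 := (E.hasSum_iUnion f hf hd ξ).mapL (innerSL ℂ ξ)
        have h2 := Complex.hasSum_re h1
        have h3 : ∀ s, MeasurableSet s → ((innerSL ℂ ξ) (E.proj s ξ)).re = ‖E.proj s ξ‖ ^ 2 :=
          fun s hs => inner_starProjection (E.isStarProjection s hs) ξ
        rw [h3 _ (MeasurableSet.iUnion hf)] at h2
        simpa only [h3 _ (hf _)] using h2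
      show ENNReal.ofReal _ = ∑' n, ENNReal.ofReal _
      rw [← hre.tsum_eq]
      exact ENNReal.ofReal_tsum_of_nonneg (fun n => by positivity) hre.summable)

/-- `E` is the spectral measure of the self-adjoint operator `a`, that is `a = ∫ t dE(t)`: the
domain of `a` is `{ξ : ∫ t² d⟪ξ, E(t) ξ⟫ < ∞}`, and `⟪ξ, a ξ⟫ = ∫ t d⟪ξ, E(t) ξ⟫` there. -/
def IsSpectralMeasure (E : ProjMeasure H) (a : H →ₗ.[ℂ] H) : Prop :=
  (∀ ξ : H, ξ ∈ a.domain ↔ MeasureTheory.Integrable (fun t : ℝ => t ^ 2) (E.scalar ξ)) ∧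
  ∀ ξ : a.domain, ⟪(ξ : H), a ξ⟫_ℂ = ((∫ t, t ∂(E.scalar (ξ : H)) : ℝ) : ℂ)

open Classical in
/-- The spectral measure `e^a` of a self-adjoint operator `a`, as a function on the Borel sets. By
the spectral theorem it exists and is unique when `a` is self-adjoint; the value for other operators
is irrelevant. -/
def spectralProj (a : H →ₗ.[ℂ] H) : Set ℝ → (H →L[ℂ] H) :=
  if h : ∃ E : ProjMeasure H, IsSpectralMeasure E a then h.choose.proj else 0

/-- `a = |x|`: the operator `a` is self-adjoint and positive, and `a² = x* x`. -/
def IsModulus (x a : H →ₗ.[ℂ] H) : Prop :=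
  IsSelfAdjoint a ∧ (∀ ξ : a.domain, 0 ≤ (⟪(ξ : H), a ξ⟫_ℂ).re) ∧
    pmul a a = pmul x.adjoint x

open Classical in
/-- The modulus `|x| = (x* x)^(1/2)`. It exists and is unique when `x` is closed and densely
defined; the value for other operators is irrelevant. -/
def modulus (x : H →ₗ.[ℂ] H) : H →ₗ.[ℂ] H :=
  if h : ∃ a, IsModulus x a then h.choose else 0

/-! ### Traces, measurable and compact operators -/

/-- `τ` is a faithful normal semifinite trace on the von Neumann algebra `M`. Only the values of `τ`
on the positive elements of `M` matter. The order is the Loewner order of bounded operators. -/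
structure IsFNSTrace (M : VonNeumannAlgebra H) (τ : (H →L[ℂ] H) → ℝ≥0∞) : Prop where
  map_add : ∀ x ∈ M, ∀ y ∈ M, 0 ≤ x → 0 ≤ y → τ (x + y) = τ x + τ y
  map_smul : ∀ (c : ℝ≥0), ∀ x ∈ M, 0 ≤ x → τ (((c : ℝ) : ℂ) • x) = (c : ℝ≥0∞) * τ x
  map_star_mul : ∀ x ∈ M, τ (star x * x) = τ (x * star x)
  faithful : ∀ x ∈ M, 0 ≤ x → τ x = 0 → x = 0
  normal : ∀ D : Set (H →L[ℂ] H), D.Nonempty → DirectedOn (· ≤ ·) D →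
    (∀ d ∈ D, d ∈ M ∧ 0 ≤ d) → ∀ x ∈ M, IsLUB D x → τ x = ⨆ d ∈ D, τ d
  semifinite : ∀ x ∈ M, 0 ≤ x → x ≠ 0 → ∃ y ∈ M, 0 ≤ y ∧ y ≤ x ∧ y ≠ 0 ∧ τ y < ∞

/-- `x` is affiliated with `M`: `y x ⊆ x y` for all `y` in the commutant of `M`. -/
def Affiliated (M : VonNeumannAlgebra H) (x : H →ₗ.[ℂ] H) : Prop :=
  ∀ y ∈ M.commutant, pmul (ofBounded y) x ≤ pmul x (ofBounded y)

/-- `x` is `τ`-measurable, that is, `x ∈ S(τ)`. -/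
structure IsTauMeasurable (M : VonNeumannAlgebra H) (τ : (H →L[ℂ] H) → ℝ≥0∞)
    (x : H →ₗ.[ℂ] H) : Prop where
  isClosed : x.IsClosed
  dense_domain : Dense (x.domain : Set H)
  affiliated : Affiliated M x
  exists_finite : ∃ r : ℝ, 0 < r ∧ τ (spectralProj (modulus x) (Set.Ioi r)) < ∞

/-- The generalized singular value function
`μ(t; x) = inf {s ≥ 0 : τ(e^|x|(s, ∞)) ≤ t} ∈ [0, ∞]`. -/
def singularValue (τ : (H →L[ℂ] H) → ℝ≥0∞) (x : H →ₗ.[ℂ] H) (t : ℝ≥0) : ℝ≥0∞ :=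
  ⨅ (s : ℝ≥0) (_ : τ (spectralProj (modulus x) (Set.Ioi (s : ℝ))) ≤ t), (s : ℝ≥0∞)

/-- `x` is `τ`-compact, that is, `x ∈ S₀(τ)`. -/
def IsTauCompact (M : VonNeumannAlgebra H) (τ : (H →L[ℂ] H) → ℝ≥0∞) (x : H →ₗ.[ℂ] H) : Prop :=
  IsTauMeasurable M τ x ∧ Filter.Tendsto (singularValue τ x) Filter.atTop (𝓝 0)

/-! ### Bimodules and derivations -/

/-- The set `𝔼`, with its structure of a normed space, is a Banach `M`-bimodule of `τ`-measurable
operators: a linear subspace of `S(τ)` (whose operations are the strong ones) which is complete,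
and for which `u x v ∈ 𝔼` with `‖u x v‖ ≤ ‖u‖ ‖v‖ ‖x‖` whenever `x ∈ 𝔼` and `u, v ∈ M`. -/
structure IsBanachBimodule (M : VonNeumannAlgebra H) (τ : (H →L[ℂ] H) → ℝ≥0∞)
    (𝔼 : Set (H →ₗ.[ℂ] H)) [NormedAddCommGroup 𝔼] [NormedSpace ℂ 𝔼] : Prop where
  measurable : ∀ x ∈ 𝔼, IsTauMeasurable M τ x
  coe_add : ∀ x y : 𝔼, ((x + y : 𝔼) : H →ₗ.[ℂ] H) = strongAdd x y
  coe_smul : ∀ (c : ℂ) (x : 𝔼), ((c • x : 𝔼) : H →ₗ.[ℂ] H) = strongSMul c x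
  mul_mul : ∀ u ∈ M, ∀ v ∈ M, ∀ x : 𝔼,
    ∃ h : strongMul (strongMul (ofBounded u) x) (ofBounded v) ∈ 𝔼,
      ‖(⟨_, h⟩ : 𝔼)‖ ≤ ‖u‖ * ‖v‖ * ‖x‖
  complete : CompleteSpace 𝔼

/-- The linear map `δ : M → 𝔼` is a derivation: `δ(x y) = δ(x) y + x δ(y)`. -/
def IsDerivation (M : VonNeumannAlgebra H) (𝔼 : Set (H →ₗ.[ℂ] H)) [NormedAddCommGroup 𝔼]
    [NormedSpace ℂ 𝔼] (δ : M.toStarSubalgebra →ₗ[ℂ] 𝔼) : Prop :=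
  ∀ x y : M.toStarSubalgebra, (δ (x * y) : H →ₗ.[ℂ] H) =
    strongAdd (strongMul (δ x) (ofBounded (y : H →L[ℂ] H)))
      (strongMul (ofBounded (x : H →L[ℂ] H)) (δ y))

end TauCompact

end

namespace AutomaticContinuity

/-! ### Gliding hump. -/

open Filter

/-! The operators in `𝔼` are closed and densely defined, so the strong operations make `𝔼` a normed
`M`-bimodule with bounded actions, and Ringrose's automatic continuity theorem applies.

For a derivation `D`, let `J` be the set of `a` such that `b ↦ D (a * b)` and `b ↦ D (b * a)`, and
the same maps for `star a`, are continuous. By uniform boundedness `J` is a closed two-sided ideal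
and `a · D b`, `D b · a` are jointly bounded on it; writing a positive element of `J` as a square
then bounds `D` on `J`.

A gliding hump puts all but finitely many members of any orthogonal sequence of projections into
`J`. Hence 1 splits into finitely many orthogonal projections, each in `J` or minimal modulo `J`.
For minimal `e`, `f` the corner `e A f` is at most one-dimensional modulo `J`, so `D` is bounded on
it, and summing over the corners gives continuity. -/

theorem continuous_of_bounded_on_ball {A X : Type*} [NormedAddCommGroup A] [NormedSpace ℂ A]
    [NormedAddCommGroup X] [NormedSpace ℂ X] (T : A →ₗ[ℂ] X) {r c : ℝ} (hr : 0 < r)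
    (h : ∀ a, ‖a‖ ≤ r → ‖T a‖ ≤ c) : Continuous T := by
  refine (T.mkContinuous (c / r) fun a => ?_).continuous
  rcases eq_or_ne a 0 with rfl | ha
  · simp
  have hn : 0 < ‖a‖ := norm_pos_iff.mpr ha
  have h1 := h (((r / ‖a‖ : ℝ) : ℂ) • a) (by
    rw [norm_smul, Complex.norm_real, Real.norm_of_nonneg (by positivity)]
    field_simp; exact le_rfl)
  rw [map_smul, norm_smul, Complex.norm_real, Real.norm_of_nonneg (by positivity)] at h1
  rw [div_mul_eq_mul_div, div_le_iff₀ hn] at h1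
  rw [div_mul_eq_mul_div, le_div_iff₀ hr]
  linarith

/-- A gliding hump argument. -/
theorem eventually_continuous_of_orthogonal {A X : Type*} [NormedAddCommGroup A] [NormedSpace ℂ A]
    [CompleteSpace A] [NormedAddCommGroup X] [NormedSpace ℂ X] (D : A →ₗ[ℂ] X)
    (m : ℕ → A →L[ℂ] A) (T : ℕ → A →ₗ[ℂ] X) (k : ℕ → ℝ) (K : ℝ)
    (hm : ∀ j a, ‖m j a‖ ≤ ‖a‖) (hidem : ∀ j a, m j (m j a) = m j a)
    (horth : ∀ i j a, i ≠ j → m i (m j a) = 0) (hT : ∀ j a, ‖T j a‖ ≤ K * ‖D a‖)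
    (hk : ∀ j a, ‖D (m j a) - T j a‖ ≤ k j * ‖a‖) :
    ∀ᶠ j in atTop, Continuous (T j) := by
  by_contra hcon
  rw [not_eventually] at hcon
  obtain ⟨φ, hφ, hφ'⟩ := extraction_of_frequently_atTop hcon
  -- The 3 pays for two errors below: `k` times `‖c‖ ≤ 2`, and `k` times `‖b j‖ ≤ 1`.
  have hb : ∀ j : ℕ, ∃ b : A, ‖b‖ ≤ (1 / 2) ^ j ∧ (j : ℝ) + 3 * |k (φ j)| < ‖T (φ j) b‖ := by
    intro j
    by_contra hne
    push Not at hne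
    exact hφ' j (continuous_of_bounded_on_ball (T (φ j)) (by positivity) hne)
  choose b hb1 hb2 using hb
  have hbd : ∀ j, ‖m (φ j) (b j)‖ ≤ (1 / 2) ^ j := fun j => (hm _ _).trans (hb1 j)
  have hsum : Summable fun j => m (φ j) (b j) :=
    Summable.of_norm_bounded summable_geometric_two hbd
  -- One vector carries every hump: `m (φ j)` sends `c` and `b j` to the same element, so `T (φ j)
  -- c` is large with `j`, against the fixed bound `K * ‖D c‖`.
  set c := ∑' j, m (φ j) (b j) with hc
  have hcn : ‖c‖ ≤ 2 := tsum_of_norm_bounded hasSum_geometric_two hbd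
  have hmc : ∀ j, m (φ j) c = m (φ j) (b j) := by
    intro j
    rw [hc, (m (φ j)).map_tsum hsum, tsum_eq_single j, hidem]
    intro i hij
    exact horth _ _ _ (fun h => hij (hφ.injective h).symm)
  obtain ⟨j, hj⟩ := exists_nat_gt (K * ‖D c‖)
  have e1 := hk (φ j) c
  have e2 := hk (φ j) (b j)
  rw [hmc j] at e1
  have e3 : ‖b j‖ ≤ 1 := (hb1 j).trans (pow_le_one₀ (by norm_num) (by norm_num))
  have e4 : k (φ j) * ‖c‖ ≤ |k (φ j)| * 2 :=
    mul_le_mul (le_abs_self _) hcn (norm_nonneg _) (abs_nonneg _)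
  have e5 : k (φ j) * ‖b j‖ ≤ |k (φ j)| * 1 :=
    mul_le_mul (le_abs_self _) e3 (norm_nonneg _) (abs_nonneg _)
  have e6 : ‖T (φ j) (b j)‖ ≤ ‖D (m (φ j) (b j)) - T (φ j) c‖ +
      ‖D (m (φ j) (b j)) - T (φ j) (b j)‖ + ‖T (φ j) c‖ := by
    have : T (φ j) (b j) = (D (m (φ j) (b j)) - T (φ j) c) -
      (D (m (φ j) (b j)) - T (φ j) (b j)) + T (φ j) c := by abel
    conv_lhs => rw [this]
    exact (norm_add_le _ _).trans (add_le_add_left (norm_sub_le _ _) _)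
  linarith [hT (φ j) c, hb2 j]

/-! ### Derivations and the continuity ideal. -/

variable {A X : Type*} [CStarAlgebra A] [NormedAddCommGroup X] [NormedSpace ℂ X]

/-- A derivation into a bimodule whose left and right actions are `L` and `R`. -/
def IsBimoduleDerivation (L R : A →L[ℂ] X →L[ℂ] X) (D : A →ₗ[ℂ] X) : Prop :=
  ∀ a b, D (a * b) = R b (D a) + L a (D b)

variable {L R : A →L[ℂ] X →L[ℂ] X} {D : A →ₗ[ℂ] X}

/-- The two maps differ by `b ↦ R b (D a)`, which is bounded. The second form depends linearly and
continuously on `a`, as closedness and uniform boundedness require. -/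
theorem IsBimoduleDerivation.continuous_left_iff (hD : IsBimoduleDerivation L R D) (a : A) :
    (Continuous fun b => D (a * b)) ↔ Continuous fun b => L a (D b) := by
  have h : Continuous fun b => R b (D a) := by fun_prop
  constructor
  · intro h1
    refine (h1.sub h).congr fun b => ?_
    simp [hD a b]
  · intro h1
    refine (h.add h1).congr fun b => ?_
    simp [hD a b]

theorem IsBimoduleDerivation.continuous_right_iff (hD : IsBimoduleDerivation L R D) (a : A) :
    (Continuous fun b => D (b * a)) ↔ Continuous fun b => R a (D b) := by
  have h : Continuous fun b => L b (D a) := by fun_prop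
  constructor
  · intro h1
    refine (h1.sub h).congr fun b => ?_
    simp [hD b a]
  · intro h1
    refine (h1.add h).congr fun b => ?_
    simp [hD b a]

/-- By Banach–Steinhaus, a pointwise limit of a sequence of continuous linear maps on a Banach space
is continuous. -/
theorem isClosed_setOf_continuous_comp (B : A →L[ℂ] X →L[ℂ] X) (D : A →ₗ[ℂ] X) :
    IsClosed {a | Continuous fun b => B a (D b)} := by
  refine isSeqClosed_iff_isClosed.mp fun u a hu ha => ?_
  let g : ℕ → A →L[ℂ] X := fun n => ⟨(B (u n)).toLinearMap ∘ₗ D, hu n⟩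
  have hg : Tendsto (fun n x => g n x) atTop (𝓝 fun b => B a (D b)) := by
    rw [tendsto_pi_nhds]
    intro b
    have : Continuous fun a => B a (D b) := by fun_prop
    exact (this.tendsto a).comp ha
  exact (continuousLinearMapOfTendsto g hg).continuous

/-- The elements `a` for which `b ↦ D (a * b)` and `b ↦ D (b * a)`, as well as the maps given in
the same way by `star a`, are continuous. -/
def continuityIdeal (D : A →ₗ[ℂ] X) : Submodule ℂ A where
  carrier := {a | ((Continuous fun b => D (a * b)) ∧ Continuous fun b => D (b * a)) ∧
    (Continuous fun b => D (star a * b)) ∧ Continuous fun b => D (b * star a)}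
  add_mem' := by
    rintro a b ⟨⟨h1, h2⟩, h3, h4⟩ ⟨⟨k1, k2⟩, k3, k4⟩
    simp only [Set.mem_ofPred_eq, star_add, add_mul, mul_add, map_add]
    exact ⟨⟨h1.add k1, h2.add k2⟩, h3.add k3, h4.add k4⟩
  zero_mem' := by simp [continuous_const]
  smul_mem' := by
    rintro c a ⟨⟨h1, h2⟩, h3, h4⟩
    simp only [Set.mem_ofPred_eq, star_smul, smul_mul_assoc, mul_smul_comm, map_smul]
    exact ⟨⟨h1.const_smul c, h2.const_smul c⟩, h3.const_smul _, h4.const_smul _⟩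

/-- The conditions on `star a` are built into the ideal for this symmetry: it turns left ideal into
right ideal and keeps real and imaginary parts inside. -/
theorem star_mem_continuityIdeal {a : A} (ha : a ∈ continuityIdeal D) :
    star a ∈ continuityIdeal D := by
  obtain ⟨h1, h2⟩ := ha
  exact ⟨h2, by simpa only [star_star] using h1⟩

theorem IsSelfAdjoint.mem_continuityIdeal {a : A} (ha : IsSelfAdjoint a)
    (h1 : Continuous fun b => D (a * b)) (h2 : Continuous fun b => D (b * a)) :
    a ∈ continuityIdeal D :=
  ⟨⟨h1, h2⟩, by rw [ha.star_eq]; exact ⟨h1, h2⟩⟩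

/-- Where `c` or `star c` is the outer factor, the derivation rule splits it off; in the other two
maps it is absorbed into the argument. -/
theorem IsBimoduleDerivation.mul_mem_left (hD : IsBimoduleDerivation L R D) (c : A) {a : A}
    (ha : a ∈ continuityIdeal D) : c * a ∈ continuityIdeal D := by
  obtain ⟨⟨h1, h2⟩, h3, h4⟩ := ha
  refine ⟨⟨?_, ?_⟩, ?_, ?_⟩
  · have : Continuous fun b => R (a * b) (D c) + L c (D (a * b)) :=
      .add (by fun_prop) ((L c).continuous.comp h1)
    refine this.congr fun b => ?_
    rw [mul_assoc, hD c]
  · exact (h2.comp (continuous_mul_const c)).congr fun b => by simp [mul_assoc]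
  · exact (h3.comp (continuous_const_mul (star c))).congr fun b => by simp [mul_assoc]
  · have : Continuous fun b => R (star c) (D (b * star a)) + L (b * star a) (D (star c)) :=
      .add ((R (star c)).continuous.comp h4) (by fun_prop)
    refine this.congr fun b => ?_
    rw [star_mul, ← mul_assoc, hD _ (star c)]

theorem IsBimoduleDerivation.mul_mem_right (hD : IsBimoduleDerivation L R D) {a : A} (c : A)
    (ha : a ∈ continuityIdeal D) : a * c ∈ continuityIdeal D := by
  have := star_mem_continuityIdeal (hD.mul_mem_left (star c) (star_mem_continuityIdeal ha))
  simpa using this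

theorem IsBimoduleDerivation.isClosed_continuityIdeal (hD : IsBimoduleDerivation L R D) :
    IsClosed (continuityIdeal D : Set A) := by
  have h : (continuityIdeal D : Set A) =
      ({a | Continuous fun b => L a (D b)} ∩ {a | Continuous fun b => R a (D b)}) ∩
      star ⁻¹' ({a | Continuous fun b => L a (D b)} ∩ {a | Continuous fun b => R a (D b)}) := by
    ext a
    simp only [Set.mem_inter_iff, Set.mem_ofPred_eq, Set.mem_preimage, ← hD.continuous_left_iff,
      ← hD.continuous_right_iff]
    rfl
  rw [h]
  have h1 := (isClosed_setOf_continuous_comp L D).inter (isClosed_setOf_continuous_comp R D)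
  exact h1.inter (h1.preimage continuous_star)

/-- A closed left ideal of a C⋆-algebra which contains `star y * y` contains `y`. -/
theorem mem_of_star_mul_self_mem {J : Submodule ℂ A} (hJ : IsClosed (J : Set A))
    (hl : ∀ c a, a ∈ J → c * a ∈ J) {y : A} (hy : star y * y ∈ J) : y ∈ J := by
  set g := star y * y with hg
  have hgs : IsSelfAdjoint g := IsSelfAdjoint.star_mul_self y
  have hgn : ∀ t ∈ spectrum ℝ g, 0 ≤ t := spectrum_star_mul_self_nonneg
  have key : ∀ ε : ℝ, 0 < ε → ∃ z ∈ J, ‖y - z‖ ^ 2 ≤ ε := by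
    intro ε hε
    -- The approximant is `y * (|g| + ε)⁻¹ * g`, with squared error the norm of `ε² t / (t + ε)²` at
    -- `g`. The absolute value keeps the function continuous on all of `ℝ` and is harmless on the
    -- spectrum.
    have hpos : ∀ t : ℝ, |t| + ε ≠ 0 := fun t => by positivity
    have c1 : Continuous fun t : ℝ => (|t| + ε)⁻¹ := by fun_prop (disch := exact hpos _)
    set q := cfc (fun t : ℝ => (|t| + ε)⁻¹) g with hq
    have hqs : IsSelfAdjoint q := cfc_predicate _ _
    have c2 : Continuous fun t : ℝ => 1 - (|t| + ε)⁻¹ * t :=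
      continuous_const.sub (c1.mul continuous_id)
    refine ⟨y * (q * g), hl _ _ (hl _ _ hy), ?_⟩
    have e1 : y - y * (q * g) = y * (1 - q * g) := by rw [mul_sub, mul_one]
    have hw : cfc (fun t : ℝ => 1 - (|t| + ε)⁻¹ * t) g = 1 - q * g := by
      rw [cfc_sub (fun _ : ℝ => 1) (fun t : ℝ => (|t| + ε)⁻¹ * t) g continuousOn_const
        (c1.mul continuous_id).continuousOn,
        cfc_mul (fun t : ℝ => (|t| + ε)⁻¹) (fun t => t) g c1.continuousOn continuousOn_id,
        cfc_id' ℝ g hgs, cfc_const_one ℝ g hgs, ← hq]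
    have hs : star (1 - q * g) = 1 - q * g := by
      rw [← hw]; exact IsSelfAdjoint.star_eq (cfc_predicate _ _)
    have e2 : star (y * (1 - q * g)) * (y * (1 - q * g)) =
        cfc (fun t : ℝ => (1 - (|t| + ε)⁻¹ * t) * t * (1 - (|t| + ε)⁻¹ * t)) g := by
      rw [star_mul, hs, cfc_mul (fun t : ℝ => (1 - (|t| + ε)⁻¹ * t) * t) _ g
        (c2.mul continuous_id).continuousOn c2.continuousOn,
        cfc_mul _ (fun t : ℝ => t) g c2.continuousOn continuousOn_id, cfc_id' ℝ g hgs, hw, hg]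
      simp only [mul_assoc]
    rw [e1, sq, ← CStarRing.norm_star_mul_self, e2]
    refine norm_cfc_le hε.le fun t ht => ?_
    have h0 := hgn t ht
    have e3 : 1 - (|t| + ε)⁻¹ * t = ε / (t + ε) := by
      rw [abs_of_nonneg h0]; field_simp; ring
    rw [e3, Real.norm_of_nonneg (by positivity), div_mul_eq_mul_div, div_mul_div_comm,
      div_le_iff₀ (by positivity)]
    nlinarith [mul_nonneg hε.le (sq_nonneg t), mul_pos hε (mul_pos hε hε), mul_nonneg h0 (mul_pos hε hε).le]
  have hcl : y ∈ closure (J : Set A) := by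
    rw [Metric.mem_closure_iff]
    intro ε hε
    obtain ⟨z, hz, hz'⟩ := key ((ε / 2) ^ 2) (by positivity)
    refine ⟨z, hz, ?_⟩
    rw [dist_eq_norm]
    have := (pow_le_pow_iff_left₀ (norm_nonneg _) (by positivity) two_ne_zero).mp hz'
    linarith
  exact hJ.closure_subset hcl

/-- The maps `a ↦ B a (D b)` with `‖b‖ ≤ 1` are pointwise bounded on the Banach space `J`, hence
uniformly bounded. -/
theorem exists_bound_of_forall_continuous (B : A →L[ℂ] X →L[ℂ] X) (D : A →ₗ[ℂ] X)
    {J : Submodule ℂ A} (hJ : IsClosed (J : Set A))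
    (h : ∀ a ∈ J, Continuous fun b => B a (D b)) :
    ∃ C, ∀ a ∈ J, ∀ b, ‖B a (D b)‖ ≤ C * ‖a‖ * ‖b‖ := by
  have : CompleteSpace J := hJ.completeSpace_coe
  let g : {b : A // ‖b‖ ≤ 1} → J →L[ℂ] X := fun b => (B.flip (D b)).comp J.subtypeL
  have hg : ∀ a : J, ∃ C, ∀ b, ‖g b a‖ ≤ C := by
    intro a
    let T : A →L[ℂ] X := ⟨(B a).toLinearMap ∘ₗ D, h a a.2⟩
    refine ⟨‖T‖, fun b => ?_⟩
    have h1 : ‖T b‖ ≤ ‖T‖ * ‖(b : A)‖ := T.le_opNorm b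
    exact h1.trans (mul_le_of_le_one_right (norm_nonneg _) b.2)
  obtain ⟨C, hC⟩ := banach_steinhaus hg
  refine ⟨C, fun a ha b => ?_⟩
  rcases eq_or_ne b 0 with rfl | hb
  · simp
  have hn : 0 < ‖b‖ := norm_pos_iff.mpr hb
  have h2 : ‖((‖b‖⁻¹ : ℝ) : ℂ) • b‖ ≤ 1 := by
    rw [norm_smul, Complex.norm_real, norm_inv, norm_norm, inv_mul_cancel₀ hn.ne']
  have h3 : ‖B a (D (((‖b‖⁻¹ : ℝ) : ℂ) • b))‖ ≤ C * ‖a‖ :=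
    ((g ⟨_, h2⟩).le_opNorm ⟨a, ha⟩).trans (mul_le_mul_of_nonneg_right (hC _) (norm_nonneg _))
  rw [map_smul, map_smul, norm_smul, Complex.norm_real, norm_inv, norm_norm,
    inv_mul_le_iff₀ hn] at h3
  linarith

/-- A derivation is bounded on its continuity ideal. -/
theorem IsBimoduleDerivation.exists_bound_on_continuityIdeal (hD : IsBimoduleDerivation L R D) :
    ∃ C, ∀ a ∈ continuityIdeal D, ‖D a‖ ≤ C * ‖a‖ := by
  let _ := CStarAlgebra.spectralOrder A
  have := CStarAlgebra.spectralOrderedRing A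
  have hcl := hD.isClosed_continuityIdeal
  obtain ⟨C₁, hC₁⟩ := exists_bound_of_forall_continuous L D hcl
    fun a ha => (hD.continuous_left_iff a).mp ha.1.1
  obtain ⟨C₂, hC₂⟩ := exists_bound_of_forall_continuous R D hcl
    fun a ha => (hD.continuous_right_iff a).mp ha.1.2
  have hsq : ∀ y, star y * y ∈ continuityIdeal D → y ∈ continuityIdeal D := fun y =>
    mem_of_star_mul_self_mem hcl fun c _ => hD.mul_mem_left c
  -- With `p = s * s` and `s` in the ideal, `D p = R s (D s) + L s (D s)`, and both terms are
  -- controlled by `‖s‖² = ‖p‖`.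
  have hpos : ∀ p ∈ continuityIdeal D, 0 ≤ p → ‖D p‖ ≤ |C₁ + C₂| * ‖p‖ := by
    intro p hp hp0
    set s := CFC.sqrt p with hs
    have hss : s * s = p := CFC.sqrt_mul_sqrt_self p hp0
    have hsa : star s = s := (CFC.sqrt_nonneg p).isSelfAdjoint.star_eq
    have hsJ : s ∈ continuityIdeal D := hsq s (by rwa [hsa, hss])
    have hn : ‖s‖ * ‖s‖ = ‖p‖ := by rw [← CStarRing.norm_star_mul_self, hsa, hss]
    have h1 := hC₁ s hsJ s
    have h2 := hC₂ s hsJ s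
    rw [mul_assoc, hn] at h1 h2
    rw [← hss, hD, hss]
    refine (norm_add_le _ _).trans ?_
    have := mul_le_mul_of_nonneg_right (le_abs_self (C₁ + C₂)) (norm_nonneg p)
    linarith
  have hself : ∀ x ∈ continuityIdeal D, IsSelfAdjoint x → ‖D x‖ ≤ 2 * |C₁ + C₂| * ‖x‖ := by
    intro x hx hxs
    have e1 : x⁺ - x⁻ = x := CFC.posPart_sub_negPart x hxs
    have p0 : 0 ≤ x⁺ := CFC.posPart_nonneg x
    have n0 : 0 ≤ x⁻ := CFC.negPart_nonneg x
    have e2 : x⁺ * x = x⁺ * x⁺ := by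
      trans x⁺ * (x⁺ - x⁻)
      · rw [e1]
      rw [mul_sub, CFC.posPart_mul_negPart, sub_zero]
    have e3 : x⁻ * x = -(x⁻ * x⁻) := by
      trans x⁻ * (x⁺ - x⁻)
      · rw [e1]
      rw [mul_sub, CFC.negPart_mul_posPart, zero_sub]
    have hp : x⁺ ∈ continuityIdeal D := hsq _ (by
      rw [p0.isSelfAdjoint.star_eq, ← e2]; exact hD.mul_mem_left _ hx)
    have hn : x⁻ ∈ continuityIdeal D := hsq _ (by
      rw [n0.isSelfAdjoint.star_eq, ← neg_neg (x⁻ * x⁻), ← e3]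
      exact neg_mem (hD.mul_mem_left _ hx))
    conv_lhs => rw [← e1, map_sub]
    refine (norm_sub_le _ _).trans ?_
    have h1 := hpos _ hp p0
    have h2 := hpos _ hn n0
    have h3 := mul_le_mul_of_nonneg_left (CStarAlgebra.norm_posPart_le x) (abs_nonneg (C₁ + C₂))
    have h4 := mul_le_mul_of_nonneg_left (CStarAlgebra.norm_negPart_le x) (abs_nonneg (C₁ + C₂))
    linarith
  refine ⟨4 * |C₁ + C₂|, fun a ha => ?_⟩
  have hst := star_mem_continuityIdeal ha
  have hre : (realPart a : A) ∈ continuityIdeal D := by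
    rw [realPart_apply_coe]
    exact Submodule.smul_of_tower_mem _ _ (add_mem ha hst)
  have him : (imaginaryPart a : A) ∈ continuityIdeal D := by
    rw [imaginaryPart_apply_coe]
    exact Submodule.smul_mem _ _ (Submodule.smul_of_tower_mem _ _ (sub_mem ha hst))
  have h1 := hself _ hre (realPart a).2
  have h2 := hself _ him (imaginaryPart a).2
  have h3 : ‖(realPart a : A)‖ ≤ ‖a‖ := realPart.norm_le a
  have h4 : ‖(imaginaryPart a : A)‖ ≤ ‖a‖ := imaginaryPart.norm_le a
  conv_lhs => rw [← realPart_add_I_smul_imaginaryPart a, map_add, map_smul]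
  refine (norm_add_le _ _).trans ?_
  rw [norm_smul, Complex.norm_I, one_mul]
  have h5 := mul_le_mul_of_nonneg_left h3 (abs_nonneg (C₁ + C₂))
  have h6 := mul_le_mul_of_nonneg_left h4 (abs_nonneg (C₁ + C₂))
  linarith

/-! ### Projections modulo the continuity ideal. -/

/-- The hump argument runs for multiplication by `e j` on each side: `D (e j * a)` and `L (e j) (D
a)` differ by `R a (D (e j))`, bounded in `a` with a constant that may depend on `j`. -/
theorem IsBimoduleDerivation.eventually_mem_continuityIdeal (hD : IsBimoduleDerivation L R D)
    (e : ℕ → A) (he : ∀ n, IsStarProjection (e n)) (horth : ∀ i j, i ≠ j → e i * e j = 0) :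
    ∀ᶠ n in atTop, e n ∈ continuityIdeal D := by
  have hn : ∀ j, ‖e j‖ ≤ 1 := fun j => (he j).norm_le
  have hl := eventually_continuous_of_orthogonal D (fun j => ContinuousLinearMap.mul ℂ A (e j))
    (fun j => (L (e j)).toLinearMap ∘ₗ D) (fun j => ‖R‖ * ‖D (e j)‖) ‖L‖
    (fun j a => (norm_mul_le _ _).trans (mul_le_of_le_one_left (norm_nonneg _) (hn j)))
    (fun j a => by simp [← mul_assoc, (he j).isIdempotentElem.eq])
    (fun i j a hij => by simp [← mul_assoc, horth i j hij])
    (fun j a => ((L (e j)).le_opNorm _).trans (mul_le_mul_of_nonneg_right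
      ((L.le_opNorm _).trans (mul_le_of_le_one_right (norm_nonneg _) (hn j))) (norm_nonneg _)))
    (fun j a => by
      have : D (e j * a) - L (e j) (D a) = R a (D (e j)) := by rw [hD]; abel
      simp only [ContinuousLinearMap.mul_apply', LinearMap.comp_apply,
        ContinuousLinearMap.coe_coe]
      rw [this]
      refine (R.le_opNorm₂ _ _).trans (le_of_eq (by ring)))
  have hr := eventually_continuous_of_orthogonal D
    (fun j => (ContinuousLinearMap.mul ℂ A).flip (e j))
    (fun j => (R (e j)).toLinearMap ∘ₗ D) (fun j => ‖L‖ * ‖D (e j)‖) ‖R‖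
    (fun j a => (norm_mul_le _ _).trans (mul_le_of_le_one_right (norm_nonneg _) (hn j)))
    (fun j a => by simp [mul_assoc, (he j).isIdempotentElem.eq])
    (fun i j a hij => by simp [mul_assoc, horth j i hij.symm])
    (fun j a => ((R (e j)).le_opNorm _).trans (mul_le_mul_of_nonneg_right
      ((R.le_opNorm _).trans (mul_le_of_le_one_right (norm_nonneg _) (hn j))) (norm_nonneg _)))
    (fun j a => by
      have : D (a * e j) - R (e j) (D a) = L a (D (e j)) := by rw [hD]; abel
      simp only [ContinuousLinearMap.flip_apply, ContinuousLinearMap.mul_apply',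
        LinearMap.comp_apply, ContinuousLinearMap.coe_coe]
      rw [this]
      refine (L.le_opNorm₂ _ _).trans (le_of_eq (by ring)))
  filter_upwards [hl, hr] with j h1 h2
  exact IsSelfAdjoint.mem_continuityIdeal (he j).isSelfAdjoint ((hD.continuous_left_iff _).mpr h1)
    ((hD.continuous_right_iff _).mpr h2)

/-- A projection outside `J` which is not the sum of two orthogonal projections outside `J`. -/
structure IsMinimalModulo (J : Submodule ℂ A) (e : A) : Prop where
  isStarProjection : IsStarProjection e
  notMem : e ∉ J
  mem_or_mem : ∀ f g, IsStarProjection f → IsStarProjection g → f * g = 0 → f + g = e →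
    f ∈ J ∨ g ∈ J

/-- A projection failing `P` splits into two projections outside `J`, at least one of which again
fails `P`. Starting from 1, keep such a half each time: the discarded halves form an orthogonal
sequence outside `J`. -/
theorem projection_induction {J : Submodule ℂ A}
    (hJ : ∀ e : ℕ → A, (∀ n, IsStarProjection (e n)) → (∀ i j, i ≠ j → e i * e j = 0) →
      ∃ n, e n ∈ J)
    {P : A → Prop} (hmem : ∀ e, IsStarProjection e → e ∈ J → P e)
    (hmin : ∀ e, IsMinimalModulo J e → P e)
    (hadd : ∀ e f, IsStarProjection e → IsStarProjection f → e * f = 0 → P e → P f → P (e + f)) :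
    P 1 := by
  by_contra h1
  have step : ∀ e : {e : A // IsStarProjection e ∧ ¬P e}, ∃ g : {e : A // IsStarProjection e ∧ ¬P e},
      IsStarProjection ((e : A) - g) ∧ (e : A) - g ∉ J ∧ (e : A) * g = g := by
    rintro ⟨e, he, hP⟩
    have hn : ¬IsMinimalModulo J e := fun h => hP (hmin e h)
    have : ∃ f g, IsStarProjection f ∧ IsStarProjection g ∧ f * g = 0 ∧ f + g = e ∧
        f ∉ J ∧ g ∉ J := by
      by_contra hcon
      push Not at hcon
      refine hn ⟨he, fun h => hP (hmem e he h), fun f g hf hg hfg hs => ?_⟩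
      by_contra hne
      push Not at hne
      exact hne.2 (hcon f g hf hg hfg hs hne.1)
    obtain ⟨f, g, hf, hg, hfg, hs, hfJ, hgJ⟩ := this
    have hgf : g * f = 0 := by
      simpa [hf.isSelfAdjoint.star_eq, hg.isSelfAdjoint.star_eq] using congrArg star hfg
    by_cases hPg : P g
    · have hPf : ¬P f := fun hPf => hP (hs ▸ hadd f g hf hg hfg hPf hPg)
      have e1 : e - f = g := by rw [← hs]; abel
      refine ⟨⟨f, hf, hPf⟩, ?_⟩
      simp only [e1]
      refine ⟨hg, hgJ, ?_⟩
      rw [← hs, add_mul, hgf, hf.isIdempotentElem.eq, add_zero]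
    · have e1 : e - g = f := by rw [← hs]; abel
      refine ⟨⟨g, hg, hPg⟩, ?_⟩
      simp only [e1]
      refine ⟨hf, hfJ, ?_⟩
      rw [← hs, add_mul, hfg, hg.isIdempotentElem.eq, zero_add]
  choose G hG1 hG2 hG3 using step
  let g : ℕ → {e : A // IsStarProjection e ∧ ¬P e} :=
    fun n => G^[n] ⟨1, IsStarProjection.one A, h1⟩
  have hg : ∀ n, g (n + 1) = G (g n) := fun n => Function.iterate_succ_apply' _ _ _
  have hle : ∀ n k, (g n : A) * g (n + k) = g (n + k) := by
    intro n k
    induction k with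
    | zero => exact (g n).2.1.isIdempotentElem.eq
    | succ k ih =>
      have h2 := hG3 (g (n + k))
      rw [← hg] at h2
      rw [← add_assoc, ← h2, ← mul_assoc, ih]
  let f : ℕ → A := fun n => (g n : A) - g (n + 1)
  have hf : ∀ n, IsStarProjection (f n) := fun n => by
    have := hG1 (g n); rwa [← hg] at this
  have hlt : ∀ i j, i < j → f i * f j = 0 := by
    intro i j hij
    obtain ⟨k, rfl⟩ := Nat.exists_eq_add_of_lt hij
    have a1 := hle i (k + 1)
    have a2 := hle i (k + 1 + 1)
    have a3 := hle (i + 1) k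
    have a4 := hle (i + 1) (k + 1)
    have n1 : i + 1 + k = i + (k + 1) := by ring
    have n2 : i + 1 + (k + 1) = i + (k + 1 + 1) := by ring
    rw [n1] at a3
    rw [n2] at a4
    change ((g i : A) - g (i + 1)) * ((g (i + (k + 1)) : A) - g (i + (k + 1 + 1))) = 0
    rw [sub_mul, mul_sub, mul_sub, a1, a2, a3, a4, sub_self]
  obtain ⟨n, hn⟩ := hJ f hf (by
    intro i j hij
    rcases lt_or_gt_of_ne hij with h | h
    · exact hlt i j h
    · have := congrArg star (hlt j i h)
      simpa [(hf i).isSelfAdjoint.star_eq, (hf j).isSelfAdjoint.star_eq] using this)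
  have h2 := hG2 (g n)
  rw [← hg] at h2
  exact h2 hn

/-- Every self-adjoint element has a support projection. -/
def HasSupportProjections (A : Type*) [CStarAlgebra A] : Prop :=
  ∀ f : A, IsSelfAdjoint f →
    ∃ p : A, IsStarProjection p ∧ p * f = f ∧ ∀ g, f * g = 0 → p * g = 0

/-- The support projection `p` of `u` lies under `e`; `u` lives on `p` and `v` on `e - p`, and
minimality puts one of these two projections in `J`. -/
theorem IsMinimalModulo.mem_or_mem_of_mul_eq_zero (hA : HasSupportProjections A)
    {J : Submodule ℂ A} (hr : ∀ a c, a ∈ J → a * c ∈ J) {e : A} (he : IsMinimalModulo J e)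
    {u v : A} (hu : IsSelfAdjoint u) (hue : u * e = u) (hev : e * v = v) (huv : u * v = 0) :
    u ∈ J ∨ v ∈ J := by
  obtain ⟨p, hp, hpu, hpg⟩ := hA u hu
  have h1 : p * e = p := by
    have : p * (1 - e) = 0 := hpg _ (by rw [mul_sub, mul_one, hue, sub_self])
    rw [mul_sub, mul_one, sub_eq_zero] at this
    exact this.symm
  have hq : IsStarProjection (e - p) := hp.sub_of_mul_eq_left he.isStarProjection h1
  have h2 : p * (e - p) = 0 := by rw [mul_sub, h1, hp.isIdempotentElem.eq, sub_self]
  rcases he.mem_or_mem p (e - p) hp hq h2 (by abel) with h | h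
  · left; rw [← hpu]; exact hr _ _ h
  · right
    have : (e - p) * v = v := by rw [sub_mul, hev, hpg v huv, sub_zero]
    rw [← this]; exact hr _ _ h

/-- The parts `(a - t)⁺` and `(a - t)⁻`, cut to the corner, have product zero, so for each `t` one
is in `J`. The two closed sets of such `t` are nonempty and cover `ℝ`, so by connectedness they
meet. -/
theorem IsMinimalModulo.exists_real_sub_mem (hA : HasSupportProjections A)
    {J : Submodule ℂ A} (hJ : IsClosed (J : Set A)) (hr : ∀ a c, a ∈ J → a * c ∈ J)
    {e : A} (he : IsMinimalModulo J e) {a : A} (ha : IsSelfAdjoint a) (hea : e * a = a) :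
    ∃ t : ℝ, a - (t : ℂ) • e ∈ J := by
  have hes : star e = e := he.isStarProjection.isSelfAdjoint.star_eq
  have hee : e * e = e := he.isStarProjection.isIdempotentElem.eq
  have hae : a * e = a := by
    simpa [ha.star_eq, hes] using congrArg star hea
  have hcomm : ∀ F : ℝ → ℝ, cfc F a * e = e * cfc F a := fun F =>
    (ha.commute_cfc (show Commute a e from hae.trans hea.symm) F).eq
  -- The calculus is taken in `A`, where its values may leave the corner; the factor `e` brings them
  -- back.
  let u : ℝ → A := fun t => e * cfc (fun s : ℝ => max (s - t) 0) a
  let v : ℝ → A := fun t => e * cfc (fun s : ℝ => max (t - s) 0) a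
  have hlip : ∀ (F : ℝ → ℝ → ℝ), (∀ t, Continuous (F t)) →
      (∀ t t' s, |F t s - F t' s| ≤ |t - t'|) → Continuous fun t => e * cfc (F t) a := by
    intro F hF hF'
    refine continuous_const.mul (LipschitzWith.continuous (K := 1)
      (LipschitzWith.of_dist_le_mul fun t t' => ?_))
    rw [dist_eq_norm, ← cfc_sub _ _ a (hF t).continuousOn (hF t').continuousOn, NNReal.coe_one,
      one_mul, Real.dist_eq]
    exact norm_cfc_le (abs_nonneg _) fun s _ => hF' t t' s
  have hu : Continuous u := hlip _ (fun t => by fun_prop) fun t t' s => by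
    refine (abs_max_sub_max_le_abs _ _ _).trans (le_of_eq ?_)
    rw [abs_sub_comm t]; congr 1; ring
  have hv : Continuous v := hlip _ (fun t => by fun_prop) fun t t' s => by
    refine (abs_max_sub_max_le_abs _ _ _).trans (le_of_eq ?_)
    congr 1; ring
  have hsub : ∀ t, u t - v t = a - (t : ℂ) • e := by
    intro t
    have h1 : cfc (fun s : ℝ => max (s - t) 0) a - cfc (fun s : ℝ => max (t - s) 0) a =
        a - algebraMap ℝ A t := by
      have c1 : Continuous fun s : ℝ => max (s - t) 0 := by fun_prop
      have c2 : Continuous fun s : ℝ => max (t - s) 0 := by fun_prop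
      rw [← cfc_sub _ _ a c1.continuousOn c2.continuousOn]
      have h2 : (fun s : ℝ => max (s - t) 0 - max (t - s) 0) = fun s => s - t := by
        funext s
        rcases le_total s t with h | h
        · rw [max_eq_right (by linarith), max_eq_left (by linarith)]; ring
        · rw [max_eq_left (by linarith), max_eq_right (by linarith)]; ring
      rw [h2, cfc_sub (fun s : ℝ => s) (fun _ => t) a continuousOn_id continuousOn_const,
        cfc_id' ℝ a ha, cfc_const t a ha]
    change e * _ - e * _ = _
    rw [← mul_sub, h1, mul_sub, hea, Algebra.algebraMap_eq_smul_one, mul_smul_comm, mul_one]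
    congr 1
  have hor : ∀ t, u t ∈ J ∨ v t ∈ J := by
    intro t
    have c1 : Continuous fun s : ℝ => max (s - t) 0 := by fun_prop
    have c2 : Continuous fun s : ℝ => max (t - s) 0 := by fun_prop
    refine he.mem_or_mem_of_mul_eq_zero hA hr ?_ ?_ ?_ ?_
    · change star (e * _) = e * _
      rw [star_mul, hes, IsSelfAdjoint.star_eq (cfc_predicate _ a), hcomm]
    · change e * _ * e = e * _
      rw [mul_assoc, hcomm, ← mul_assoc, hee]
    · change e * (e * _) = e * _
      rw [← mul_assoc, hee]
    · change e * _ * (e * _) = 0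
      rw [mul_assoc, ← mul_assoc _ e, hcomm, mul_assoc,
        ← cfc_mul _ _ a c1.continuousOn c2.continuousOn]
      have : (fun s : ℝ => max (s - t) 0 * max (t - s) 0) = fun _ => 0 := by
        funext s
        rcases le_total s t with h | h
        · rw [max_eq_right (by linarith), zero_mul]
        · rw [max_eq_right (a := t - s) (by linarith), mul_zero]
      rw [this, cfc_const_zero, mul_zero, mul_zero]
  have hspec : ∀ s ∈ spectrum ℝ a, |s| ≤ ‖a‖ * ‖(1 : A)‖ := fun s hs =>
    spectrum.norm_le_norm_mul_of_mem hs
  have hun : u (‖a‖ * ‖(1 : A)‖) ∈ J := by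
    have : cfc (fun s : ℝ => max (s - ‖a‖ * ‖(1 : A)‖) 0) a = 0 := by
      rw [← norm_le_zero_iff]
      refine norm_cfc_le le_rfl fun s hs => ?_
      rw [max_eq_right (by linarith [le_abs_self s, hspec s hs]), norm_zero]
    change e * _ ∈ J
    rw [this, mul_zero]; exact J.zero_mem
  have hvn : v (-(‖a‖ * ‖(1 : A)‖)) ∈ J := by
    have : cfc (fun s : ℝ => max (-(‖a‖ * ‖(1 : A)‖) - s) 0) a = 0 := by
      rw [← norm_le_zero_iff]
      refine norm_cfc_le le_rfl fun s hs => ?_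
      rw [max_eq_right (by linarith [neg_abs_le s, hspec s hs]), norm_zero]
    change e * _ ∈ J
    rw [this, mul_zero]; exact J.zero_mem
  obtain ⟨t, -, ht1, ht2⟩ := isPreconnected_closed_iff.mp (isPreconnected_univ (α := ℝ))
    (u ⁻¹' J) (v ⁻¹' J) (hJ.preimage hu) (hJ.preimage hv) (fun t _ => hor t)
    ⟨_, trivial, hun⟩ ⟨_, trivial, hvn⟩
  exact ⟨t, hsub t ▸ J.sub_mem ht1 ht2⟩

theorem IsMinimalModulo.exists_sub_smul_mem (hA : HasSupportProjections A)
    {J : Submodule ℂ A} (hJ : IsClosed (J : Set A)) (hr : ∀ a c, a ∈ J → a * c ∈ J)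
    {e : A} (he : IsMinimalModulo J e) (a : A) :
    ∃ z : ℂ, e * a * e - z • e ∈ J := by
  have hes : star e = e := he.isStarProjection.isSelfAdjoint.star_eq
  have hee : e * e = e := he.isStarProjection.isIdempotentElem.eq
  have key : ∀ b : A, IsSelfAdjoint b → ∃ t : ℝ, e * b * e - (t : ℂ) • e ∈ J := by
    intro b hb
    refine he.exists_real_sub_mem hA hJ hr ?_ (by rw [← mul_assoc, ← mul_assoc, hee])
    rw [IsSelfAdjoint, star_mul, star_mul, hes, hb.star_eq, mul_assoc]
  obtain ⟨s, hs⟩ := key _ (realPart a).2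
  obtain ⟨t, ht⟩ := key _ (imaginaryPart a).2
  refine ⟨s + Complex.I * t, ?_⟩
  have := J.add_mem hs (J.smul_mem Complex.I ht)
  convert this using 1
  conv_lhs => rw [← realPart_add_I_smul_imaginaryPart a]
  simp only [mul_add, add_mul, mul_smul_comm, smul_mul_assoc, smul_sub, add_smul, mul_smul]
  abel

/-- Modulo a closed ideal, the corner between two minimal projections is at most
one-dimensional. -/
theorem IsMinimalModulo.exists_forall_sub_smul_mem (hA : HasSupportProjections A)
    {J : Submodule ℂ A} (hJ : IsClosed (J : Set A)) (hl : ∀ c a, a ∈ J → c * a ∈ J)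
    (hr : ∀ a c, a ∈ J → a * c ∈ J) {e f : A} (he : IsMinimalModulo J e)
    (hf : IsMinimalModulo J f) {x : A} (hx : e * x * f ∉ J) (y : A) :
    ∃ z : ℂ, e * y * f - z • (e * x * f) ∈ J := by
  have hfs : star f = f := hf.isStarProjection.isSelfAdjoint.star_eq
  have hff : f * f = f := hf.isStarProjection.isIdempotentElem.eq
  have hes : star e = e := he.isStarProjection.isSelfAdjoint.star_eq
  have hee : e * e = e := he.isStarProjection.isIdempotentElem.eq
  obtain ⟨m, hm⟩ := hf.exists_sub_smul_mem hA hJ hr (star x * e * x)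
  obtain ⟨l, hlm⟩ := he.exists_sub_smul_mem hA hJ hr (y * f * star x)
  set w := e * x * f with hw
  have hws : star w = f * star x * e := by
    rw [hw, star_mul, star_mul, hes, hfs, mul_assoc]
  have e1 : star w * w = f * (star x * e * x) * f := by
    rw [hws, hw]; simp only [mul_assoc]; rw [← mul_assoc e e, hee]
  have e2 : e * y * f * star w = e * (y * f * star x) * e := by
    rw [hws]; simp only [mul_assoc]; rw [← mul_assoc f f, hff]
  rw [← e1] at hm
  rw [← e2] at hlm
  have hm0 : m ≠ 0 := by
    rintro rfl
    rw [zero_smul, sub_zero] at hm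
    exact hx (mem_of_star_mul_self_mem hJ hl hm)
  -- Modulo `J`, the product `e y f (star w) w` is both `l • w` and `m • (e y f)`.
  have h1 := hr _ w hlm
  have h2 := hl (e * y * f) _ hm
  have h3 := J.sub_mem h1 h2
  have h4 : (e * y * f * star w - l • e) * w - e * y * f * (star w * w - m • f) =
      m • (e * y * f) - l • w := by
    have e3 : e * w = w := by rw [hw, ← mul_assoc, ← mul_assoc, hee]
    have e4 : e * y * f * f = e * y * f := by rw [mul_assoc, hff]
    rw [sub_mul, mul_sub, smul_mul_assoc, e3, mul_smul_comm, e4, mul_assoc]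
    abel
  rw [h4] at h3
  refine ⟨m⁻¹ * l, ?_⟩
  have := J.smul_mem m⁻¹ h3
  rwa [smul_sub, smul_smul, smul_smul, inv_mul_cancel₀ hm0, one_smul] at this

/-! ### Ringrose's theorem. -/

/-- Hahn–Banach in `A ⧸ J`. The functional later reads off, with a bound, the coefficient of an
element of a corner modulo `J`. -/
theorem exists_functional_of_notMem {J : Submodule ℂ A} (hJ : IsClosed (J : Set A)) {x : A}
    (hx : x ∉ J) : ∃ φ : A →L[ℂ] ℂ, (∀ a ∈ J, φ a = 0) ∧ φ x = 1 := by
  have : IsClosed (J : Set A) := hJ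
  have hne : ‖(Submodule.Quotient.mk x : A ⧸ J)‖ ≠ 0 := by
    rw [norm_ne_zero_iff, ne_eq, Submodule.Quotient.mk_eq_zero]; exact hx
  obtain ⟨g, -, hg⟩ := exists_dual_vector ℂ _ hne
  let π : A →L[ℂ] A ⧸ J := J.mkQ.mkContinuous 1 fun a => by
    rw [one_mul]; exact Submodule.Quotient.norm_mk_le J a
  let n : ℂ := (‖(Submodule.Quotient.mk x : A ⧸ J)‖ : ℂ)
  refine ⟨n⁻¹ • g.comp π, fun a ha => ?_, ?_⟩
  · have : π a = 0 := (Submodule.Quotient.mk_eq_zero J).mpr ha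
    simp [this]
  · change n⁻¹ * g (Submodule.Quotient.mk x) = 1
    rw [hg]
    exact inv_mul_cancel₀ (Complex.ofReal_ne_zero.mpr hne)

/-- **Ringrose's theorem**, for C⋆-algebras with support projections: a derivation into a bimodule
is continuous. -/
theorem IsBimoduleDerivation.continuous (hA : HasSupportProjections A)
    (hD : IsBimoduleDerivation L R D) : Continuous D := by
  have hJ := hD.isClosed_continuityIdeal
  have hl : ∀ c a, a ∈ continuityIdeal D → c * a ∈ continuityIdeal D :=
    fun c _ => hD.mul_mem_left c
  have hr : ∀ a c, a ∈ continuityIdeal D → a * c ∈ continuityIdeal D :=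
    fun _ c => hD.mul_mem_right c
  have hseq : ∀ e : ℕ → A, (∀ n, IsStarProjection (e n)) → (∀ i j, i ≠ j → e i * e j = 0) →
      ∃ n, e n ∈ continuityIdeal D := fun e he horth =>
    (hD.eventually_mem_continuityIdeal e he horth).exists
  obtain ⟨C, hC⟩ := hD.exists_bound_on_continuityIdeal
  have hpair : ∀ e f, IsMinimalModulo (continuityIdeal D) e →
      IsMinimalModulo (continuityIdeal D) f → Continuous fun x => D (e * x * f) := by
    intro e f he hf
    let T : A →L[ℂ] A := (ContinuousLinearMap.mul ℂ A e).comp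
      ((ContinuousLinearMap.mul ℂ A).flip f)
    have hT : ∀ x, T x = e * x * f := fun x => by simp [T, mul_assoc]
    suffices h : ∃ B, ∀ x, ‖D (T x)‖ ≤ B * ‖T x‖ by
      obtain ⟨B, hB⟩ := h
      have hc := ((D ∘ₗ T.toLinearMap).mkContinuous (|B| * ‖T‖) fun x =>
        (hB x).trans (by
          rw [mul_assoc]
          exact mul_le_mul (le_abs_self B) (T.le_opNorm x) (norm_nonneg _) (abs_nonneg _))).continuous
      exact hc.congr fun x => by simp [hT]
    by_cases hall : ∀ x, e * x * f ∈ continuityIdeal D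
    · exact ⟨C, fun x => hC _ (by rw [hT]; exact hall x)⟩
    push Not at hall
    obtain ⟨x₀, hx₀⟩ := hall
    obtain ⟨φ, hφ, hφ1⟩ := exists_functional_of_notMem hJ hx₀
    set w := e * x₀ * f with hw
    -- Split `T x` as `(T x - z • w) + z • w`: the first term is in the ideal, where `C` applies,
    -- and `z = φ (T x)`.
    refine ⟨|C| * (1 + ‖φ‖ * ‖w‖) + ‖φ‖ * ‖D w‖, fun x => ?_⟩
    obtain ⟨z, hz⟩ := he.exists_forall_sub_smul_mem hA hJ hl hr hf hx₀ x
    rw [← hT, ← hw] at hz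
    have hzφ : φ (T x) = z := by
      have := hφ _ hz
      rwa [map_sub, map_smul, hφ1, smul_eq_mul, mul_one, sub_eq_zero] at this
    have hzn : ‖z‖ ≤ ‖φ‖ * ‖T x‖ := hzφ ▸ φ.le_opNorm _
    have h1 := (hC _ hz).trans (mul_le_mul_of_nonneg_right (le_abs_self C) (norm_nonneg _))
    have h2 : ‖T x - z • w‖ ≤ ‖T x‖ + ‖φ‖ * ‖T x‖ * ‖w‖ := by
      refine (norm_sub_le _ _).trans (add_le_add_right ?_ _)
      rw [norm_smul]
      exact mul_le_mul_of_nonneg_right hzn (norm_nonneg _)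
    have h3 : D (T x) = D (T x - z • w) + z • D w := by rw [map_sub, map_smul]; abel
    have h4 : ‖z • D w‖ ≤ ‖φ‖ * ‖T x‖ * ‖D w‖ := by
      rw [norm_smul]; exact mul_le_mul_of_nonneg_right hzn (norm_nonneg _)
    rw [h3]
    refine (norm_add_le _ _).trans ?_
    have h5 := mul_le_mul_of_nonneg_left h2 (abs_nonneg C)
    refine (add_le_add (h1.trans h5) h4).trans (le_of_eq (by ring))
  -- The induction runs once per side: first on the left projection with `f` minimal, then on the
  -- right with 1 on the left.
  have hleft : ∀ f, IsMinimalModulo (continuityIdeal D) f → Continuous fun x => D (1 * x * f) := by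
    intro f hf
    refine projection_induction hseq (P := fun e => Continuous fun x => D (e * x * f))
      (fun e _ he => ?_) (fun e he => hpair e f he hf) (fun e e' _ _ _ h1 h2 => ?_)
    · exact (he.1.1.comp (continuous_mul_const f)).congr fun x => by simp [mul_assoc]
    · exact (h1.add h2).congr fun x => by simp [add_mul]
  have hone : Continuous fun x => D (1 * x * 1) := by
    refine projection_induction hseq (P := fun f => Continuous fun x => D (1 * x * f))
      (fun f _ hf => ?_) hleft (fun f f' _ _ _ h1 h2 => ?_)
    · exact hf.1.2.congr fun x => by simp
    · exact (h1.add h2).congr fun x => by simp [mul_add]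
  exact hone.congr fun x => by simp

end AutomaticContinuity

namespace TauCompact

universe u

variable {H : Type u} [NormedAddCommGroup H] [InnerProductSpace ℂ H]

/-! ### Graphs -/

theorem mem_graph_ofBounded {u : H →L[ℂ] H} {ξ η : H} :
    (ξ, η) ∈ (ofBounded u).graph ↔ u ξ = η := by
  rw [LinearPMap.mem_graph_iff]
  constructor
  · rintro ⟨y, rfl, h⟩; exact h
  · intro h; exact ⟨⟨ξ, trivial⟩, rfl, h⟩

theorem mem_graph_pmul {x y : H →ₗ.[ℂ] H} {ξ η : H} :
    (ξ, η) ∈ (pmul x y).graph ↔ ∃ ζ, (ξ, ζ) ∈ y.graph ∧ (ζ, η) ∈ x.graph := by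
  constructor
  · rw [LinearPMap.mem_graph_iff]
    rintro ⟨⟨z, hz, hz'⟩, rfl, h⟩
    exact ⟨y ⟨z, hz⟩, y.mem_graph ⟨z, hz⟩, by
      dsimp only at h; rw [← h]; exact x.mem_graph ⟨_, hz'⟩⟩
  · rintro ⟨ζ, h1, h2⟩
    obtain ⟨a, rfl, ha⟩ := LinearPMap.mem_graph_iff _ |>.mp h1
    obtain ⟨b, hb, hb'⟩ := LinearPMap.mem_graph_iff _ |>.mp h2
    dsimp only at ha hb hb'
    have hm : y a ∈ x.domain := by rw [ha, ← hb]; exact b.2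
    have : b = ⟨y a, hm⟩ := Subtype.ext (hb.trans ha.symm)
    subst this
    exact (LinearPMap.mem_graph_iff _).mpr ⟨⟨a, a.2, hm⟩, rfl, hb'⟩

theorem mem_graph_add {x y : H →ₗ.[ℂ] H} {ξ η : H} :
    (ξ, η) ∈ (x + y).graph ↔ ∃ a b, (ξ, a) ∈ x.graph ∧ (ξ, b) ∈ y.graph ∧ a + b = η := by
  constructor
  · rw [LinearPMap.mem_graph_iff]
    rintro ⟨⟨z, hz, hz'⟩, rfl, h⟩
    exact ⟨_, _, x.mem_graph ⟨z, hz⟩, y.mem_graph ⟨z, hz'⟩, h⟩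
  · rintro ⟨a, b, h1, h2, rfl⟩
    obtain ⟨a', ha, rfl⟩ := LinearPMap.mem_graph_iff _ |>.mp h1
    obtain ⟨b', hb, rfl⟩ := LinearPMap.mem_graph_iff _ |>.mp h2
    dsimp only at ha hb
    subst ha
    have hm : (a' : H) ∈ y.domain := by rw [← hb]; exact b'.2
    have : b' = ⟨a', hm⟩ := Subtype.ext hb
    subst this
    exact (LinearPMap.mem_graph_iff _).mpr ⟨⟨a', a'.2, hm⟩, rfl, rfl⟩

theorem mem_graph_smul {c : ℂ} {x : H →ₗ.[ℂ] H} {ξ η : H} :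
    (ξ, η) ∈ (c • x).graph ↔ ∃ a, (ξ, a) ∈ x.graph ∧ c • a = η := by
  constructor
  · rw [LinearPMap.mem_graph_iff]
    rintro ⟨z, rfl, h⟩
    exact ⟨_, x.mem_graph z, h⟩
  · rintro ⟨a, h1, rfl⟩
    obtain ⟨a', ha, rfl⟩ := LinearPMap.mem_graph_iff _ |>.mp h1
    exact (LinearPMap.mem_graph_iff _).mpr ⟨a', ha, rfl⟩

theorem closure_eq_self {f : H →ₗ.[ℂ] H} (hf : f.IsClosed) : f.closure = f :=
  LinearPMap.eq_of_eq_graph (by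
    rw [← hf.isClosable.graph_closure_eq_closure_graph]
    exact hf.submodule_topologicalClosure_eq)

theorem closure_closure_eq (f : H →ₗ.[ℂ] H) : f.closure.closure = f.closure := by
  by_cases hf : f.IsClosable
  · exact closure_eq_self hf.closure_isClosed
  · rw [LinearPMap.closure_def' hf, LinearPMap.closure_def' hf]

theorem closure_graph_induction {f : H →ₗ.[ℂ] H} (hf : f.closure.IsClosed) {S : Set (H × H)}
    (hS : IsClosed S) (h : ∀ ξ η, (ξ, η) ∈ f.graph → (ξ, η) ∈ S) {ξ η : H}
    (hξ : (ξ, η) ∈ f.closure.graph) : (ξ, η) ∈ S := by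
  -- The closure of a map that is not closable is by default the map itself, so closability must be
  -- recovered from closedness of `f.closure`.
  have hc : f.IsClosable := hf.isClosable.leIsClosable f.le_closure
  rw [← hc.graph_closure_eq_closure_graph] at hξ
  exact closure_minimal (fun p hp => h p.1 p.2 hp) hS hξ

theorem pmul_ofBounded_one (y : H →ₗ.[ℂ] H) : pmul y (ofBounded 1) = y := by
  refine LinearPMap.eq_of_eq_graph (Submodule.ext ?_)
  rintro ⟨ξ, η⟩
  simp [mem_graph_pmul, mem_graph_ofBounded, -LinearPMap.mem_graph_iff]

theorem ofBounded_one_pmul (y : H →ₗ.[ℂ] H) : pmul (ofBounded 1) y = y := by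
  refine LinearPMap.eq_of_eq_graph (Submodule.ext ?_)
  rintro ⟨ξ, η⟩
  simp [mem_graph_pmul, mem_graph_ofBounded, -LinearPMap.mem_graph_iff]

variable [CompleteSpace H]

/-! ### Support projections -/

theorem isClosed_coe_vonNeumannAlgebra (M : VonNeumannAlgebra H) :
    IsClosed (M.toStarSubalgebra : Set (H →L[ℂ] H)) := by
  rw [VonNeumannAlgebra.coe_toStarSubalgebra, ← M.centralizer_centralizer]
  exact Set.isClosed_centralizer _

/-- Take the projection onto the closed range of `f`. The commutant leaves this range invariant, so
the projection is in `M`; and `f * g = 0` sends `g` into `ker f`, the orthogonal complement of the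
range. -/
theorem exists_supportProjection (M : VonNeumannAlgebra H) {f : H →L[ℂ] H} (hf : f ∈ M)
    (hfs : IsSelfAdjoint f) :
    ∃ p ∈ M, IsStarProjection p ∧ p * f = f ∧ ∀ g : H →L[ℂ] H, f * g = 0 → p * g = 0 := by
  let K : Submodule ℂ H := f.range.topologicalClosure
  have hK : CompleteSpace K := f.range.isClosed_topologicalClosure.completeSpace_coe
  have hp : IsStarProjection K.starProjection := isStarProjection_starProjection
  refine ⟨K.starProjection, ?_, hp, ?_, fun g hg => ?_⟩
  · rw [VonNeumannAlgebra.IsStarProjection.mem_iff hp]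
    intro y hy
    have hyf : f * y = y * f := VonNeumannAlgebra.mem_commutant_iff.mp hy f hf
    rw [Module.End.mem_invtSubmodule]
    have hr : K.starProjection.range = K := Submodule.range_starProjection K
    rw [hr]
    refine Submodule.topologicalClosure_minimal _ ?_
      (f.range.isClosed_topologicalClosure.preimage y.continuous)
    rintro _ ⟨ξ, rfl⟩
    refine f.range.le_topologicalClosure ⟨y ξ, ?_⟩
    exact congrArg (fun q : H →L[ℂ] H => q ξ) hyf
  · ext ξ
    exact Submodule.starProjection_eq_self_iff.mpr (f.range.le_topologicalClosure ⟨ξ, rfl⟩)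
  · ext ξ
    refine (Submodule.starProjection_apply_eq_zero_iff K).mpr ?_
    rw [Submodule.orthogonal_closure, Submodule.mem_orthogonal]
    rintro _ ⟨η, rfl⟩
    have h1 : f (g ξ) = 0 := congrArg (fun q : H →L[ℂ] H => q ξ) hg
    have h2 : ⟪f η, g ξ⟫_ℂ = ⟪η, f (g ξ)⟫_ℂ := by
      conv_rhs => rw [← hfs.star_eq]
      exact (ContinuousLinearMap.adjoint_inner_right f η (g ξ)).symm
    exact h2.trans (by rw [h1, inner_zero_right])

/-! ### The bimodule operations -/

variable {M : VonNeumannAlgebra H} {τ : (H →L[ℂ] H) → ℝ≥0∞} {𝔼 : Set (H →ₗ.[ℂ] H)}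
  [NormedAddCommGroup 𝔼] [NormedSpace ℂ 𝔼]

namespace IsBanachBimodule

theorem isClosed (h : IsBanachBimodule M τ 𝔼) (x : 𝔼) : (x : H →ₗ.[ℂ] H).IsClosed :=
  (h.measurable x x.2).isClosed

theorem mem_graph_add (h : IsBanachBimodule M τ 𝔼) {x y : 𝔼} {ξ a b : H}
    (ha : (ξ, a) ∈ (x : H →ₗ.[ℂ] H).graph) (hb : (ξ, b) ∈ (y : H →ₗ.[ℂ] H).graph) :
    (ξ, a + b) ∈ ((x + y : 𝔼) : H →ₗ.[ℂ] H).graph := by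
  rw [h.coe_add]
  exact LinearPMap.le_graph_of_le (LinearPMap.le_closure _)
    (TauCompact.mem_graph_add.mpr ⟨a, b, ha, hb, rfl⟩)

theorem mem_graph_smul (h : IsBanachBimodule M τ 𝔼) (c : ℂ) {x : 𝔼} {ξ a : H}
    (ha : (ξ, a) ∈ (x : H →ₗ.[ℂ] H).graph) :
    (ξ, c • a) ∈ ((c • x : 𝔼) : H →ₗ.[ℂ] H).graph := by
  rw [h.coe_smul]
  exact LinearPMap.le_graph_of_le (LinearPMap.le_closure _)
    (TauCompact.mem_graph_smul.mpr ⟨a, ha, rfl⟩)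

theorem add_graph_induction (h : IsBanachBimodule M τ 𝔼) {x y : 𝔼} {S : Set (H × H)}
    (hS : IsClosed S) (hxy : ∀ ξ a b, (ξ, a) ∈ (x : H →ₗ.[ℂ] H).graph →
      (ξ, b) ∈ (y : H →ₗ.[ℂ] H).graph → (ξ, a + b) ∈ S) {ξ η : H}
    (hξ : (ξ, η) ∈ ((x + y : 𝔼) : H →ₗ.[ℂ] H).graph) : (ξ, η) ∈ S := by
  have hc := h.isClosed (x + y)
  rw [h.coe_add] at hξ hc
  refine closure_graph_induction hc hS (fun ξ η hp => ?_) hξ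
  obtain ⟨a, b, ha, hb, rfl⟩ := TauCompact.mem_graph_add.mp hp
  exact hxy ξ a b ha hb

theorem smul_graph_induction (h : IsBanachBimodule M τ 𝔼) {c : ℂ} {x : 𝔼} {S : Set (H × H)}
    (hS : IsClosed S) (hx : ∀ ξ a, (ξ, a) ∈ (x : H →ₗ.[ℂ] H).graph → (ξ, c • a) ∈ S) {ξ η : H}
    (hξ : (ξ, η) ∈ ((c • x : 𝔼) : H →ₗ.[ℂ] H).graph) : (ξ, η) ∈ S := by
  have hc := h.isClosed (c • x)
  rw [h.coe_smul] at hξ hc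
  refine closure_graph_induction hc hS (fun ξ η hp => ?_) hξ
  obtain ⟨a, ha, rfl⟩ := TauCompact.mem_graph_smul.mp hp
  exact hx ξ a ha

/-- Since `𝔼` is a group for the strong sum, inclusions between its elements are equalities. -/
theorem eq_of_le (h : IsBanachBimodule M τ 𝔼) {y z : 𝔼}
    (hyz : (y : H →ₗ.[ℂ] H).graph ≤ (z : H →ₗ.[ℂ] H).graph) : y = z := by
  -- The zero of `𝔼` is only given abstractly; being `0 • y`, it is closed and vanishes on a dense
  -- subspace, so it is the zero operator on all of `H`.
  have hzero : ∀ ξ, (ξ, (0 : H)) ∈ ((0 : 𝔼) : H →ₗ.[ℂ] H).graph := by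
    intro ξ
    have hd : Dense {ξ | (ξ, (0 : H)) ∈ ((0 : 𝔼) : H →ₗ.[ℂ] H).graph} := by
      refine (h.measurable y y.2).dense_domain.mono fun ξ hξ => ?_
      have := h.mem_graph_smul 0 ((y : H →ₗ.[ℂ] H).mem_graph ⟨ξ, hξ⟩)
      rwa [zero_smul, zero_smul] at this
    have hc : IsClosed {ξ | (ξ, (0 : H)) ∈ ((0 : 𝔼) : H →ₗ.[ℂ] H).graph} :=
      (h.isClosed 0).preimage (by fun_prop : Continuous fun ξ : H => (ξ, (0 : H)))
    have : ξ ∈ closure {ξ | (ξ, (0 : H)) ∈ ((0 : 𝔼) : H →ₗ.[ℂ] H).graph} := hd ξ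
    rwa [hc.closure_eq] at this
  -- `0 = y - y` is contained in `z - y`, and an everywhere defined operator has no proper
  -- extension.
  have hle : ∀ ξ η, (ξ, η) ∈ ((0 : 𝔼) : H →ₗ.[ℂ] H).graph →
      (ξ, η) ∈ ((z + (-1 : ℂ) • y : 𝔼) : H →ₗ.[ℂ] H).graph := by
    intro ξ η hξ
    have h0 : (0 : 𝔼) = y + (-1 : ℂ) • y := by rw [neg_one_smul, add_neg_cancel]
    rw [h0] at hξ
    exact h.add_graph_induction (h.isClosed _)
      (fun ξ a b ha hb => h.mem_graph_add (hyz ha) hb) hξ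
  have heq : ((z + (-1 : ℂ) • y : 𝔼) : H →ₗ.[ℂ] H).graph = ((0 : 𝔼) : H →ₗ.[ℂ] H).graph := by
    refine le_antisymm ?_ fun (p : H × H) hp => hle p.1 p.2 hp
    rintro ⟨ξ, η⟩ hp
    have h1 := LinearPMap.mem_graph_snd_inj _ hp (hle ξ 0 (hzero ξ)) rfl
    rw [h1]; exact hzero ξ
  have h2 : z + (-1 : ℂ) • y = 0 := Subtype.ext (LinearPMap.eq_of_eq_graph heq)
  rw [neg_one_smul, ← sub_eq_add_neg, sub_eq_zero] at h2
  exact h2.symm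

theorem strongMul_left (h : IsBanachBimodule M τ 𝔼) {u : H →L[ℂ] H} (hu : u ∈ M) (x : 𝔼) :
    ∃ hm : strongMul (ofBounded u) x ∈ 𝔼, ‖(⟨_, hm⟩ : 𝔼)‖ ≤ ‖u‖ * ‖x‖ := by
  obtain ⟨hm, hle⟩ := h.mul_mul u hu 1 (one_mem M) x
  have he : strongMul (strongMul (ofBounded u) x) (ofBounded 1) = strongMul (ofBounded u) x := by
    unfold strongMul
    rw [pmul_ofBounded_one, closure_closure_eq]
  simp only [he] at hm hle
  refine ⟨hm, hle.trans ?_⟩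
  have : ‖u‖ * ‖(1 : H →L[ℂ] H)‖ ≤ ‖u‖ :=
    mul_le_of_le_one_right (norm_nonneg _) ContinuousLinearMap.norm_id_le
  exact mul_le_mul_of_nonneg_right this (norm_nonneg _)

theorem strongMul_right (h : IsBanachBimodule M τ 𝔼) {v : H →L[ℂ] H} (hv : v ∈ M) (x : 𝔼) :
    ∃ hm : strongMul x (ofBounded v) ∈ 𝔼, ‖(⟨_, hm⟩ : 𝔼)‖ ≤ ‖v‖ * ‖x‖ := by
  obtain ⟨hm, hle⟩ := h.mul_mul 1 (one_mem M) v hv x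
  have he : strongMul (ofBounded 1) (x : H →ₗ.[ℂ] H) = x := by
    unfold strongMul
    rw [ofBounded_one_pmul, closure_eq_self (h.isClosed x)]
  simp only [he] at hm hle
  refine ⟨hm, hle.trans ?_⟩
  have : ‖(1 : H →L[ℂ] H)‖ * ‖v‖ ≤ ‖v‖ :=
    mul_le_of_le_one_left (norm_nonneg _) ContinuousLinearMap.norm_id_le
  exact mul_le_mul_of_nonneg_right this (norm_nonneg _)

/-- The left action of `M` on `𝔼`. -/
noncomputable def leftMul (h : IsBanachBimodule M τ 𝔼) (u : M.toStarSubalgebra) (x : 𝔼) : 𝔼 :=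
  ⟨strongMul (ofBounded (u : H →L[ℂ] H)) x, (h.strongMul_left u.2 x).1⟩

/-- The right action of `M` on `𝔼`. -/
noncomputable def rightMul (h : IsBanachBimodule M τ 𝔼) (v : M.toStarSubalgebra) (x : 𝔼) : 𝔼 :=
  ⟨strongMul x (ofBounded (v : H →L[ℂ] H)), (h.strongMul_right v.2 x).1⟩

theorem mem_graph_leftMul (h : IsBanachBimodule M τ 𝔼) (u : M.toStarSubalgebra) {x : 𝔼} {ξ a : H}
    (ha : (ξ, a) ∈ (x : H →ₗ.[ℂ] H).graph) :
    (ξ, (u : H →L[ℂ] H) a) ∈ (h.leftMul u x : H →ₗ.[ℂ] H).graph :=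
  LinearPMap.le_graph_of_le (LinearPMap.le_closure _)
    (mem_graph_pmul.mpr ⟨a, ha, mem_graph_ofBounded.mpr rfl⟩)

theorem leftMul_graph_induction (h : IsBanachBimodule M τ 𝔼) {u : M.toStarSubalgebra} {x : 𝔼}
    {S : Set (H × H)} (hS : IsClosed S)
    (hx : ∀ ξ a, (ξ, a) ∈ (x : H →ₗ.[ℂ] H).graph → (ξ, (u : H →L[ℂ] H) a) ∈ S) {ξ η : H}
    (hξ : (ξ, η) ∈ (h.leftMul u x : H →ₗ.[ℂ] H).graph) : (ξ, η) ∈ S := by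
  refine closure_graph_induction (h.isClosed (h.leftMul u x)) hS (fun ξ η hp => ?_) hξ
  obtain ⟨a, ha, hb⟩ := mem_graph_pmul.mp hp
  rw [← mem_graph_ofBounded.mp hb]
  exact hx ξ a ha

/-- The graph of `x v` is a preimage of the closed graph of `x`, so taking the closure adds nothing;
on the left this can fail. -/
theorem mem_graph_rightMul_iff (h : IsBanachBimodule M τ 𝔼) (v : M.toStarSubalgebra) {x : 𝔼}
    {ξ η : H} : (ξ, η) ∈ (h.rightMul v x : H →ₗ.[ℂ] H).graph ↔
      ((v : H →L[ℂ] H) ξ, η) ∈ (x : H →ₗ.[ℂ] H).graph := by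
  constructor
  · intro hξ
    have hc : IsClosed {p : H × H | ((v : H →L[ℂ] H) p.1, p.2) ∈ (x : H →ₗ.[ℂ] H).graph} :=
      (h.isClosed x).preimage (by fun_prop : Continuous fun p : H × H => ((v : H →L[ℂ] H) p.1, p.2))
    refine closure_graph_induction (h.isClosed (h.rightMul v x)) hc (fun ξ η hp => ?_) hξ
    obtain ⟨a, ha, hb⟩ := mem_graph_pmul.mp hp
    rw [← mem_graph_ofBounded.mp ha] at hb
    exact hb
  · intro hξ
    exact LinearPMap.le_graph_of_le (LinearPMap.le_closure _)
      (mem_graph_pmul.mpr ⟨_, mem_graph_ofBounded.mpr rfl, hξ⟩)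

/-- The left action of `M` on `𝔼`, as a continuous bilinear map. -/
noncomputable def leftMulCLM (h : IsBanachBimodule M τ 𝔼) : M.toStarSubalgebra →L[ℂ] 𝔼 →L[ℂ] 𝔼 :=
  LinearMap.mkContinuous₂ (LinearMap.mk₂ ℂ h.leftMul
    -- By `eq_of_le` one inclusion suffices, and it need only be checked before taking closures.
    (fun u v x => h.eq_of_le fun ⟨_, _⟩ hp => h.leftMul_graph_induction (h.isClosed _)
      (fun _ _ ha => h.mem_graph_add (h.mem_graph_leftMul u ha) (h.mem_graph_leftMul v ha)) hp)
    (fun c u x => h.eq_of_le fun ⟨_, _⟩ hp => h.leftMul_graph_induction (h.isClosed _)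
      (fun _ _ ha => h.mem_graph_smul c (h.mem_graph_leftMul u ha)) hp)
    (fun u x y => h.eq_of_le fun ⟨_, _⟩ hp => h.leftMul_graph_induction (h.isClosed _)
      (fun _ _ ha => h.add_graph_induction
        (S := {p | (p.1, (u : H →L[ℂ] H) p.2) ∈ (h.leftMul u x + h.leftMul u y : 𝔼).1.graph})
        ((h.isClosed _).preimage (by fun_prop))
        (fun _ _ _ hb hc => by
          simp only [Set.mem_ofPred_eq, map_add]
          exact h.mem_graph_add (h.mem_graph_leftMul u hb) (h.mem_graph_leftMul u hc)) ha) hp)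
    (fun c u x => h.eq_of_le fun ⟨_, _⟩ hp => h.leftMul_graph_induction (h.isClosed _)
      (fun _ _ ha => h.smul_graph_induction
        (S := {p | (p.1, (u : H →L[ℂ] H) p.2) ∈ (c • h.leftMul u x : 𝔼).1.graph})
        ((h.isClosed _).preimage (by fun_prop))
        (fun _ _ hb => by
          simp only [Set.mem_ofPred_eq, map_smul]
          exact h.mem_graph_smul c (h.mem_graph_leftMul u hb)) ha) hp)) 1
    (fun u x => by rw [one_mul]; exact (h.strongMul_left u.2 x).2)

/-- The right action of `M` on `𝔼`, as a continuous bilinear map. -/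
noncomputable def rightMulCLM (h : IsBanachBimodule M τ 𝔼) : M.toStarSubalgebra →L[ℂ] 𝔼 →L[ℂ] 𝔼 :=
  LinearMap.mkContinuous₂ (LinearMap.mk₂ ℂ h.rightMul
    (fun u v x => Eq.symm <| h.eq_of_le fun ⟨_, _⟩ hp => h.add_graph_induction (h.isClosed _)
      (fun _ _ _ ha hb => (h.mem_graph_rightMul_iff _).mpr
        (Submodule.add_mem _ ((h.mem_graph_rightMul_iff _).mp ha)
          ((h.mem_graph_rightMul_iff _).mp hb))) hp)
    (fun c u x => Eq.symm <| h.eq_of_le fun ⟨_, _⟩ hp => h.smul_graph_induction (h.isClosed _)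
      (fun _ _ ha => (h.mem_graph_rightMul_iff _).mpr
        (Submodule.smul_mem _ c ((h.mem_graph_rightMul_iff _).mp ha))) hp)
    (fun u x y => Eq.symm <| h.eq_of_le fun ⟨_, _⟩ hp => h.add_graph_induction (h.isClosed _)
      (fun _ _ _ ha hb => (h.mem_graph_rightMul_iff _).mpr
        (h.mem_graph_add ((h.mem_graph_rightMul_iff _).mp ha)
          ((h.mem_graph_rightMul_iff _).mp hb))) hp)
    (fun c u x => Eq.symm <| h.eq_of_le fun ⟨_, _⟩ hp => h.smul_graph_induction (h.isClosed _)
      (fun _ _ ha => (h.mem_graph_rightMul_iff _).mpr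
        (h.mem_graph_smul c ((h.mem_graph_rightMul_iff _).mp ha))) hp)) 1
    (fun u x => by rw [one_mul]; exact (h.strongMul_right u.2 x).2)

end IsBanachBimodule

end TauCompact

/-! ### The theorem on bimodules of compact operators. -/

theorem theorem3p5 {H : Type*} [NormedAddCommGroup H] [InnerProductSpace ℂ H] [CompleteSpace H]
    (M : VonNeumannAlgebra H) (τ : (H →L[ℂ] H) → ℝ≥0∞) (hτ : TauCompact.IsFNSTrace M τ)
    (𝔼 : Set (H →ₗ.[ℂ] H)) [NormedAddCommGroup 𝔼] [NormedSpace ℂ 𝔼]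
    (h𝔼 : TauCompact.IsBanachBimodule M τ 𝔼)
    (hcompact : ∀ x ∈ 𝔼, TauCompact.IsTauCompact M τ x)
    (δ : M.toStarSubalgebra →ₗ[ℂ] 𝔼) (hδ : TauCompact.IsDerivation M 𝔼 δ) :
    Continuous δ := by
  -- Closedness in norm is what makes `M` a C⋆-algebra by instance search.
  have hcl := TauCompact.isClosed_coe_vonNeumannAlgebra M
  refine AutomaticContinuity.IsBimoduleDerivation.continuous (A := M.toStarSubalgebra)
    (L := h𝔼.leftMulCLM) (R := h𝔼.rightMulCLM) (D := δ) ?_ ?_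
  · intro f hf
    obtain ⟨p, hpM, hp, hpf, hpg⟩ := TauCompact.exists_supportProjection M f.2
      (show IsSelfAdjoint (f : H →L[ℂ] H) from congrArg Subtype.val hf)
    refine ⟨⟨p, hpM⟩, ⟨Subtype.ext hp.isIdempotentElem, Subtype.ext hp.isSelfAdjoint⟩,
      Subtype.ext hpf, fun g hg => Subtype.ext (hpg g (congrArg Subtype.val hg))⟩
  · intro a b
    refine Subtype.ext ?_
    rw [h𝔼.coe_add]
    exact hδ a b
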